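/- Let $k\ge 1$, $n\ge 2$, $[m]=\{1,\dots,m\}$. Let $F=([k],E_F)$ be a directed tree rooted at node $1$, without loops: node $1$ has no incoming edge and every $i\ge 2$ has exactly one incoming edge $(i^-,i)\in E_F$, the nodes being ordered so that $i^-<i$. Let $\mathcal G=([n],A,\alpha)$ be a network, i.e. $A:[n]^2\to[0,\infty)$ and $\alpha:[n]\to(0,1]$ is a probability vector, such that every $a\in[n]$ has some $b$ with $A(a,b)>0$. Define on $[n]^{[k]}$ the probability distribution $$\pi_{F\to\mathcal G}(\mathbf x)=\frac1{\mathtt Z}\prod_{(i,j)\in E_F}A(\mathbf x(i),\mathbf x(j))\;\prod_{i=1}^k\alpha(\mathbf x(i)),$$ with $\mathtt Z$ the normalizing constant, and call $\mathbf x$ a homomorphism if $\pi_{F\to\mathcal G}(\mathbf x)>0$. Let $\pi^{(1)}(a)=\pi_{F\to\mathcal G}(\mathbf x(1)=a)$ be the marginal at the root, let $$\Psi(a,b)=\frac{\alpha(a)\max(A(a,b),A(b,a))\,\alpha(b)}{\sum_{c}\alpha(a)\max(A(a,c),A(c,a))\,\alpha(c)},$$ and assume that $\mathcal G$ is irreducible,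 i.e. the Markov chain on $[n]$ with kernel $\Psi$ is irreducible. Let $P$ be its Metropolis–Hastings modification: for $b\ne a$, $$P(a,b)=\Psi(a,b)\min\Big(\frac{\pi^{(1)}(b)\Psi(b,a)}{\pi^{(1)}(a)\Psi(a,b)},1\Big)\quad(\text{and }P(a,b)=0\text{ if }\Psi(a,b)=0),\qquad P(a,a)=1-\sum_{c\neq a}P(a,c).$$ The pivot chain $(\mathbf x_t)_{t\ge0}$ is the Markov chain of homomorphisms $F\to\mathcal G$, started from an arbitrary (possibly random) homomorphism $\mathbf x_0$, in which at each step the root location $\mathbf x_t(1)$ moves to $\mathbf x_{t+1}(1)$ according to $P$, and then $\mathbf x_{t+1}(2),\dots,\mathbf x_{t+1}(k)$ are sampled from $\pi_{F\to\mathcal G}$ conditioned on the root location $\mathbf x_{t+1}(1)$. Let $$t^{(1)}_{mix}(\varepsilon)=\inf\Big\{t\ge0:\max_{a\in[n]}\tfrac12\sum_{b\in[n]}|P^t(a,b)-\pi^{(1)}(b)|\le\varepsilon\Big\}\in\{0,1,2,\dots\}\cup\{\infty\}$$ be the mixing time of the pivot $\mathbf x_t(1)$. **Theorem.** Let $g:[n]^{[k]}\to\mathbb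 R$ be any functional and let $c>0$ satisfy $|g(\mathbf x)-g(\mathbf y)|\le c$ for all homomorphisms $\mathbf x,\mathbf y:F\to\mathcal G$. Then for every $\delta>0$ and every integer $N\ge1$, $$\mathbb P\left(\left|\mathbb E_{\pi_{F\to\mathcal G}}[g(\mathbf x)]-\frac1N\sum_{t=1}^N g(\mathbf x_t)\right|\ge\delta\right)<2\exp\left(\frac{-2\delta^2N}{9\,c^2\,t^{(1)}_{mix}(1/4)}\right),$$ where the right-hand side is read as $2$ if $t^{(1)}_{mix}(1/4)=\infty$. In particular, if $g$ has oscillation at most $1$ on homomorphisms (e.g. $g$ takes values in $[0,1]$), one may take $c=1$. -/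

import Mathlib

open scoped BigOperators

namespace PivotChain

/-- A network on the node set `Fin n`: a matrix of nonnegative interaction strengths and a
strictly positive probability vector of node weights. -/
structure Network (n : ℕ) where
  A : Fin n → Fin n → ℝ
  α : Fin n → ℝ
  A_nonneg : ∀ a b, 0 ≤ A a b
  α_pos : ∀ a, 0 < α a
  α_sum : ∑ a, α a = 1

/-- A motif on the node set `Fin k`: a nonnegative matrix of edge weights. -/
structure Motif (k : ℕ) where
  A : Fin k → Fin k → ℝ
  A_nonneg : ∀ i j, 0 ≤ A i j

/-- `F` is (the 0-1 edge matrix of) a directed tree rooted at the first node `0`, without loops,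
with nodes listed so that the parent `i⁻` of each node `i ≠ 0` satisfies `i⁻ < i`. -/
def Motif.IsRootedTree {k : ℕ} [NeZero k] (F : Motif k) : Prop :=
  (∀ i j, F.A i j = 0 ∨ F.A i j = 1) ∧
  (∀ j, F.A j 0 = 0) ∧
  ∀ i, i ≠ 0 → ∃ p, p < i ∧ ∀ j, 0 < F.A j i ↔ j = p

noncomputable section

/-- The unnormalized weight
`(∏_{i,j} A(x(i), x(j)) ^ A_F(i,j)) α(x(1)) ⋯ α(x(k))` of a vertex map `x : [k] → [n]`,
with `0 ^ 0 = 1`. -/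
def homWeight {k n : ℕ} (F : Motif k) (G : Network n) (x : Fin k → Fin n) : ℝ :=
  (∏ i, ∏ j, G.A (x i) (x j) ^ F.A i j) * ∏ i, G.α (x i)

/-- The homomorphism density `t(F, G)`, the normalizing constant. -/
def homDensity {k n : ℕ} (F : Motif k) (G : Network n) : ℝ :=
  ∑ x : Fin k → Fin n, homWeight F G x

/-- The probability distribution `π_{F → G}` on vertex maps `[k] → [n]`. -/
def homDist {k n : ℕ} (F : Motif k) (G : Network n) (x : Fin k → Fin n) : ℝ :=
  homWeight F G x / homDensity F G

/-- A homomorphism `F → G` is a vertex map charged by `π_{F → G}`. -/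
def IsHom {k n : ℕ} (F : Motif k) (G : Network n) (x : Fin k → Fin n) : Prop :=
  0 < homDist F G x

/-- The expectation of `g` under `π_{F → G}`. -/
def homMean {k n : ℕ} (F : Motif k) (G : Network n) (g : (Fin k → Fin n) → ℝ) : ℝ :=
  ∑ x, homDist F G x * g x

/-- The marginal `π⁽¹⁾` of `π_{F → G}` at the location of the root. -/
def rootMarginal {k n : ℕ} [NeZero k] (F : Motif k) (G : Network n) (a : Fin n) : ℝ :=
  ∑ x with x 0 = a, homDist F G x

/-- The random walk kernel `Ψ` on the network. -/
def walkKernel {n : ℕ} (G : Network n) : Matrix (Fin n) (Fin n) ℝ := fun a b =>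
  G.α a * max (G.A a b) (G.A b a) * G.α b /
    ∑ c, G.α a * max (G.A a c) (G.A c a) * G.α c

/-- The network is irreducible if the random walk with kernel `Ψ`, started anywhere, reaches
every node with positive probability. -/
def Network.IsIrreducible {n : ℕ} (G : Network n) : Prop :=
  ∀ a b, ∃ t : ℕ, 0 < (walkKernel G ^ t) a b

/-- The Metropolis-Hastings acceptance probability `λ` of a move `a ↦ b`. -/
def acceptProb {k n : ℕ} [NeZero k] (F : Motif k) (G : Network n) (a b : Fin n) : ℝ :=
  min (rootMarginal F G b * walkKernel G b a / (rootMarginal F G a * walkKernel G a b)) 1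

/-- The transition kernel `P` of the pivot: propose according to `Ψ`, accept with
probability `λ`. -/
def rootKernel {k n : ℕ} [NeZero k] (F : Motif k) (G : Network n) :
    Matrix (Fin n) (Fin n) ℝ := fun a b =>
  if b = a then 1 - ∑ c with c ≠ a, walkKernel G a c * acceptProb F G a c
  else walkKernel G a b * acceptProb F G a b

/-- The transition kernel of the pivot chain: the root moves according to `P`, and then the
other nodes are sampled from `π_{F → G}` conditioned on the new location of the root. -/
def chainKernel {k n : ℕ} [NeZero k] (F : Motif k) (G : Network n)
    (x y : Fin k → Fin n) : ℝ :=
  rootKernel F G (x 0) (y 0) * (homDist F G y / rootMarginal F G (y 0))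

/-- Total variation distance on a finite set. -/
def tvDist {S : Type*} [Fintype S] (μ ν : S → ℝ) : ℝ :=
  1 / 2 * ∑ s, |μ s - ν s|

/-- The mixing time `inf {t ≥ 0 : max_x ‖P^t(x, ·) - π‖_TV ≤ ε}` of a transition matrix `P` with
stationary distribution `π`; it is `⊤` when there is no such `t`. -/
def mixingTime {S : Type*} [Fintype S] [DecidableEq S] (P : Matrix S S ℝ) (π : S → ℝ)
    (ε : ℝ) : ℕ∞ :=
  ⨅ t ∈ {t : ℕ | ∀ x, tvDist ((P ^ t) x) π ≤ ε}, (t : ℕ∞)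

end

/-- `X` is a time-homogeneous Markov chain with transition probabilities `K`: given the history
`X 0 = x 0, …, X t = x t`, the next state is `x (t+1)` with probability `K (x t) (x (t+1))`. -/
def IsMarkovChain {S Ω : Type*} [MeasurableSpace Ω] (μ : MeasureTheory.Measure Ω)
    (K : S → S → ℝ) (X : ℕ → Ω → S) : Prop :=
  ∀ (t : ℕ) (x : ℕ → S),
    μ.real {ω | ∀ s ≤ t + 1, X s ω = x s} =
      μ.real {ω | ∀ s ≤ t, X s ω = x s} * K (x t) (x (t + 1))

end PivotChain

/-! Cut the time axis into blocks of length `τ`, the mixing time of the pivot, with the remainder `N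
% τ` as last block. Let `h_N(x)` be the mean of `f(x_1) + ⋯ + f(x_N)` from `x_0 = x`, where `f` has
oscillation at most `c`. Then `h_{τ+N} = h_τ + K^τ h_N`. If `h_N` has oscillation `o`, mixing puts
`K^τ h_N` within `o/4` of a constant, so `h_{τ+N}` has oscillation at most `τc + o/2`; the fixed
point of this recursion is `2τc`. Given the start of a block, the block sum plus `h_N` at the
block's end lies in an interval of length `τc + o` and has mean `h_{τ+N}`. Hoeffding's lemma
therefore adds `(τc + o)²` to the variance term `V`, at the fixed point `9τ²c²` per block: this is
the constant `9` (`exists_mgf_bound`). The bias of `h_N` against `N` times the stationary mean fits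
in the slack of the first block (`exists_mgf_bias_bound`), and Chernoff's method concludes for any
initial law. Only the pivot has to mix: beyond one step, powers of the full kernel factor through
the root (`chainKernel_pow_mulVec`). -/

namespace PivotChain

/-! ### Hoeffding's lemma with an affine majorant -/

section Hoeffding
open MeasureTheory ProbabilityTheory

/-- Hoeffding's lemma in chord form: on `[lo, hi]` the convex function `z ↦ exp (l z)` lies below
an affine function, which lies below `m ↦ exp (l m + l² (hi - lo)² / 8)`. -/
theorem exists_affine_hoeffding (lo hi l : ℝ) :
    ∃ p q : ℝ, (∀ z ∈ Set.Icc lo hi, Real.exp (l * z) ≤ p + q * z) ∧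
      ∀ m ∈ Set.Icc lo hi, p + q * m ≤ Real.exp (l * m + l ^ 2 * (hi - lo) ^ 2 / 8) := by
  rcases le_or_gt hi lo with h | h
  · refine ⟨Real.exp (l * lo), 0, fun z hz => ?_, fun m hm => ?_⟩
    · rw [show z = lo by linarith [hz.1, hz.2]]; simp
    · rw [show m = lo by linarith [hm.1, hm.2], zero_mul, add_zero]
      exact Real.exp_le_exp.2 (by nlinarith [sq_nonneg (l * (hi - lo))])
  have hd : 0 < hi - lo := by linarith
  refine ⟨(hi * Real.exp (l * lo) - lo * Real.exp (l * hi)) / (hi - lo),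
    (Real.exp (l * hi) - Real.exp (l * lo)) / (hi - lo), fun z hz => ?_, fun m hm => ?_⟩
  · have hc := convexOn_exp.2 (Set.mem_univ (l * lo)) (Set.mem_univ (l * hi))
      (div_nonneg (sub_nonneg.2 hz.2) hd.le) (div_nonneg (sub_nonneg.2 hz.1) hd.le)
      (by field_simp; ring)
    simp only [smul_eq_mul] at hc
    have e1 : (hi - z) / (hi - lo) * (l * lo) + (z - lo) / (hi - lo) * (l * hi) = l * z := by
      field_simp; ring
    rw [e1] at hc
    refine hc.trans (le_of_eq ?_)
    field_simp; ring
  · set w : ℝ := (m - lo) / (hi - lo) with hw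
    have hw0 : 0 ≤ w := div_nonneg (by linarith [hm.1]) hd.le
    have hw1 : 0 ≤ 1 - w := by
      rw [hw, sub_nonneg, div_le_one hd]; linarith [hm.2]
    have hwm : w * (hi - lo) = m - lo := by rw [hw]; field_simp
    -- The two-point law on `{lo, hi}` with mean `m`: the chord evaluated at `m` is its exponential
    -- moment, to which the measure-theoretic Hoeffding lemma applies.
    let ν : Measure ℝ := ENNReal.ofReal (1 - w) • Measure.dirac lo +
      ENNReal.ofReal w • Measure.dirac hi
    have : IsProbabilityMeasure ν := ⟨by
      simp only [ν, Measure.add_apply, Measure.smul_apply, measure_univ, smul_eq_mul, mul_one]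
      rw [← ENNReal.ofReal_add hw1 hw0]; simp⟩
    have hint : ∀ φ : ℝ → ℝ, ∫ z, φ z ∂ν = (1 - w) * φ lo + w * φ hi := fun φ => by
      rw [integral_add_measure, integral_smul_measure, integral_smul_measure, integral_dirac,
        integral_dirac, ENNReal.toReal_ofReal hw1, ENNReal.toReal_ofReal hw0]
      · rfl
      · exact (integrable_dirac (by simp)).smul_measure (by simp)
      · exact (integrable_dirac (by simp)).smul_measure (by simp)
    have hmem : ∀ᵐ z ∂ν, id z ∈ Set.Icc lo hi := by
      change ν (Set.Icc lo hi)ᶜ = 0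
      simp only [ν, Measure.add_apply, Measure.smul_apply, smul_eq_mul]
      rw [Measure.dirac_apply' _ measurableSet_Icc.compl,
        Measure.dirac_apply' _ measurableSet_Icc.compl]
      simp [h.le]
    have key := (hasSubgaussianMGF_of_mem_Icc (μ := ν) (X := id) aemeasurable_id hmem).mgf_le l
    rw [mgf, hint, hint] at key
    have hmean : (1 - w) * id lo + w * id hi = m := by
      simp only [id]; linarith
    rw [hmean] at key
    simp only [id, NNReal.coe_pow, NNReal.coe_div, coe_nnnorm, Real.norm_eq_abs,
      NNReal.coe_ofNat] at key
    have e2 : (hi * Real.exp (l * lo) - lo * Real.exp (l * hi)) / (hi - lo) +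
        (Real.exp (l * hi) - Real.exp (l * lo)) / (hi - lo) * m =
        Real.exp (l * m) * ((1 - w) * Real.exp (l * (lo - m)) + w * Real.exp (l * (hi - m))) := by
      have a1 : Real.exp (l * m) * Real.exp (l * (lo - m)) = Real.exp (l * lo) := by
        rw [← Real.exp_add]; ring_nf
      have a2 : Real.exp (l * m) * Real.exp (l * (hi - m)) = Real.exp (l * hi) := by
        rw [← Real.exp_add]; ring_nf
      rw [mul_add, mul_left_comm, mul_left_comm _ w, a1, a2, hw]
      field_simp; ring
    rw [e2, Real.exp_add]
    refine mul_le_mul_of_nonneg_left (key.trans (Real.exp_le_exp.2 (le_of_eq ?_)))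
      (Real.exp_pos _).le
    rw [div_pow, sq_abs]; ring

end Hoeffding

/-! ### Exponential moments over one block -/

section PathExpectation
variable {S : Type*} [Fintype S]

/-- The expectation of `φ (s + f (x 1) + ⋯ + f (x N), x N)` for the Markov chain with kernel `K`
started at `x 0 = x`. -/
def pathExpectation (K : Matrix S S ℝ) (f : S → ℝ) (φ : ℝ → S → ℝ) : ℕ → ℝ → S → ℝ
  | 0, s, x => φ s x
  | N + 1, s, x => ∑ y, K x y * pathExpectation K f φ N (s + f y) y

/-- One step of the recursion for expected additive functionals: `h ↦ K (f + h)`. -/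
def additiveStep (K : Matrix S S ℝ) (f h : S → ℝ) : S → ℝ :=
  fun x => ∑ y, K x y * (f y + h y)

variable {K : Matrix S S ℝ} {f : S → ℝ}

theorem pathExpectation_add (φ : ℝ → S → ℝ) (L N : ℕ) (s : ℝ) (x : S) :
    pathExpectation K f φ (L + N) s x =
      pathExpectation K f (pathExpectation K f φ N) L s x := by
  induction L generalizing s x with
  | zero => simp [pathExpectation]
  | succ L ih => simp only [Nat.add_right_comm L 1 N, pathExpectation, ih]

/-- After `L` steps the running sum is confined to `[s + L a, s + L b]`, so a comparison is needed
only there; this lets a chord bound on an interval be used. -/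
theorem pathExpectation_mono (hK : ∀ x y, 0 ≤ K x y) {a b : ℝ}
    (hf : ∀ x, f x ∈ Set.Icc a b) {φ ψ : ℝ → S → ℝ} (L : ℕ) (s : ℝ) (x : S)
    (h : ∀ s' ∈ Set.Icc (s + L * a) (s + L * b), ∀ y, φ s' y ≤ ψ s' y) :
    pathExpectation K f φ L s x ≤ pathExpectation K f ψ L s x := by
  induction L generalizing s x with
  | zero => exact h s (by simp) x
  | succ L ih =>
    refine Finset.sum_le_sum fun y _ => mul_le_mul_of_nonneg_left (ih _ _ fun s' hs' z => ?_)
      (hK x y)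
    refine h s' ⟨?_, ?_⟩ z
    · push_cast; linarith [hs'.1, (hf y).1]
    · push_cast; linarith [hs'.2, (hf y).2]

/-- Expectations of affine functions see only the mean; this identifies iterates of `additiveStep`
with the mean of the sum plus `h` at the end point. -/
theorem pathExpectation_affine (hK1 : ∀ x, ∑ y, K x y = 1) (p q : ℝ) (h : S → ℝ) (L : ℕ)
    (s : ℝ) (x : S) :
    pathExpectation K f (fun s y => p + q * (s + h y)) L s x =
      p + q * (s + (additiveStep K f)^[L] h x) := by
  induction L generalizing s x with
  | zero => rfl
  | succ L ih =>
    simp only [pathExpectation, ih, Function.iterate_succ_apply', additiveStep]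
    have : ∀ y, K x y * (p + q * (s + f y + (additiveStep K f)^[L] h y)) =
        (p + q * s) * K x y + q * (K x y * (f y + (additiveStep K f)^[L] h y)) := fun y => by ring
    simp only [this, Finset.sum_add_distrib, ← Finset.mul_sum, hK1]
    ring

theorem pathExpectation_mul_left (r : ℝ) (φ : ℝ → S → ℝ) (L : ℕ) (s : ℝ) (x : S) :
    pathExpectation K f (fun s y => r * φ s y) L s x = r * pathExpectation K f φ L s x := by
  induction L generalizing s x with
  | zero => rfl
  | succ L ih => simp only [pathExpectation, ih, Finset.mul_sum, mul_left_comm r]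

/-- Hoeffding's lemma for an additive functional of a path of length `L`, plus a function of the
end point. -/
theorem pathExpectation_exp_le (hK : ∀ x y, 0 ≤ K x y) (hK1 : ∀ x, ∑ y, K x y = 1)
    {a c u o : ℝ} (hf : ∀ x, f x ∈ Set.Icc a (a + c)) {h : S → ℝ}
    (hh : ∀ x, h x ∈ Set.Icc u (u + o)) (l : ℝ) (L : ℕ) (s : ℝ) (x : S) :
    pathExpectation K f (fun s y => Real.exp (l * (s + h y))) L s x ≤
      Real.exp (l * (s + (additiveStep K f)^[L] h x) + l ^ 2 * (L * c + o) ^ 2 / 8) := by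
  obtain ⟨p, q, h1, h2⟩ := exists_affine_hoeffding (s + L * a + u) (s + L * (a + c) + (u + o)) l
  have hb := pathExpectation_affine (f := f) hK1 0 1 h L s x
  have hmem : s + (additiveStep K f)^[L] h x ∈
      Set.Icc (s + L * a + u) (s + L * (a + c) + (u + o)) := by
    rw [zero_add, one_mul] at hb
    rw [← hb]
    -- With slope `0` the affine formula gives the expectation of a constant; monotonicity then
    -- places the mean in the interval.
    have hconst := fun r : ℝ => pathExpectation_affine (K := K) (f := f) hK1 r 0 h L s x
    constructor
    · have := hconst (s + L * a + u)
      simp only [zero_mul, add_zero] at this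
      rw [← this]
      exact pathExpectation_mono hK hf L s x fun s' hs' y => by linarith [hs'.1, (hh y).1]
    · have := hconst (s + L * (a + c) + (u + o))
      simp only [zero_mul, add_zero] at this
      rw [← this]
      exact pathExpectation_mono hK hf L s x fun s' hs' y => by linarith [hs'.2, (hh y).2]
  have e := h2 _ hmem
  rw [show s + L * (a + c) + (u + o) - (s + L * a + u) = L * c + o by ring] at e
  refine le_trans ?_ e
  rw [← pathExpectation_affine hK1 p q h L s x]
  refine pathExpectation_mono hK hf L s x fun s' hs' y => h1 _ ⟨?_, ?_⟩
  · linarith [hs'.1, (hh y).1]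
  · linarith [hs'.2, (hh y).2]

/-- Markov property at time `L`: the bound for the last `N` steps depends on the past only through
the running sum and `h` at the current state, so Hoeffding on the first `L` steps applies to it. -/
theorem pathExpectation_exp_block (hK : ∀ x y, 0 ≤ K x y) (hK1 : ∀ x, ∑ y, K x y = 1)
    {a c u o V : ℝ} (hf : ∀ x, f x ∈ Set.Icc a (a + c)) {h : S → ℝ}
    (hh : ∀ x, h x ∈ Set.Icc u (u + o)) (l : ℝ) (L N : ℕ)
    (hN : ∀ s x, pathExpectation K f (fun s _ => Real.exp (l * s)) N s x ≤
      Real.exp (l * (s + h x) + l ^ 2 * V / 8)) (s : ℝ) (x : S) :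
    pathExpectation K f (fun s _ => Real.exp (l * s)) (L + N) s x ≤
      Real.exp (l * (s + (additiveStep K f)^[L] h x) +
        l ^ 2 * (V + (L * c + o) ^ 2) / 8) := by
  rw [pathExpectation_add]
  refine (pathExpectation_mono (ψ := fun s y => Real.exp (l ^ 2 * V / 8) *
    Real.exp (l * (s + h y))) hK hf L s x fun s' _ y => ?_).trans ?_
  · rw [← Real.exp_add, add_comm]; exact hN s' y
  · rw [pathExpectation_mul_left]
    refine (mul_le_mul_of_nonneg_left (pathExpectation_exp_le hK hK1 hf hh l L s x)
      (Real.exp_pos _).le).trans (le_of_eq ?_)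
    rw [← Real.exp_add]; ring_nf

theorem sum_stochastic_mem (hK : ∀ x y, 0 ≤ K x y) (hK1 : ∀ x, ∑ y, K x y = 1)
    {h : S → ℝ} {u v : ℝ} (hh : ∀ x, h x ∈ Set.Icc u v) (x : S) :
    ∑ y, K x y * h y ∈ Set.Icc u v := by
  constructor
  · calc u = ∑ y, K x y * u := by rw [← Finset.sum_mul, hK1, one_mul]
      _ ≤ _ := Finset.sum_le_sum fun y _ => mul_le_mul_of_nonneg_left (hh y).1 (hK x y)
  · calc _ ≤ ∑ y, K x y * v :=
          Finset.sum_le_sum fun y _ => mul_le_mul_of_nonneg_left (hh y).2 (hK x y)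
      _ = v := by rw [← Finset.sum_mul, hK1, one_mul]

theorem additiveStep_iterate_zero_mem (hK : ∀ x y, 0 ≤ K x y) (hK1 : ∀ x, ∑ y, K x y = 1)
    {a b : ℝ} (hf : ∀ x, f x ∈ Set.Icc a b) (L : ℕ) (x : S) :
    (additiveStep K f)^[L] 0 x ∈ Set.Icc (L * a) (L * b) := by
  induction L generalizing x with
  | zero => simp
  | succ L ih =>
    rw [Function.iterate_succ_apply']
    refine sum_stochastic_mem hK hK1 (h := fun y => f y + (additiveStep K f)^[L] 0 y)
      (fun y => ⟨?_, ?_⟩) x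
    · push_cast; linarith [(hf y).1, (ih y).1]
    · push_cast; linarith [(hf y).2, (ih y).2]

theorem additiveStep_iterate_eq [DecidableEq S] (h : S → ℝ) (L : ℕ) :
    (additiveStep K f)^[L] h = (additiveStep K f)^[L] 0 + (K ^ L).mulVec h := by
  induction L with
  | zero => simp
  | succ L ih =>
    rw [Function.iterate_succ_apply', Function.iterate_succ_apply', ih, pow_succ',
      ← Matrix.mulVec_mulVec]
    generalize (K ^ L).mulVec h = v
    ext x
    simp [additiveStep, Matrix.mulVec, dotProduct, mul_add, Finset.sum_add_distrib, add_assoc]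

theorem additiveStep_mean {π : S → ℝ} (hst : ∀ y, ∑ x, π x * K x y = π y) (h : S → ℝ) :
    ∑ x, π x * additiveStep K f h x = ∑ x, π x * f x + ∑ x, π x * h x := by
  simp only [additiveStep, Finset.mul_sum]
  rw [Finset.sum_comm, ← Finset.sum_add_distrib]
  refine Finset.sum_congr rfl fun y _ => ?_
  rw [← hst y, Finset.sum_mul, Finset.sum_mul, ← Finset.sum_add_distrib]
  exact Finset.sum_congr rfl fun x _ => by ring

theorem additiveStep_iterate_mean {π : S → ℝ} (hst : ∀ y, ∑ x, π x * K x y = π y) (N : ℕ) :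
    ∑ x, π x * (additiveStep K f)^[N] 0 x = N * ∑ x, π x * f x := by
  induction N with
  | zero => simp
  | succ N ih =>
    rw [Function.iterate_succ_apply', additiveStep_mean hst, ih]
    push_cast; ring

/-! ### Iterating over blocks of length `τ` -/

variable [DecidableEq S]

/-- The data of a sub-Gaussian bound with variance proxy `V / 4` for the sum over `N` steps, whose
expectation has oscillation at most `o` as a function of the starting point. -/
theorem exists_mgf_bound (hK : ∀ x y, 0 ≤ K x y) (hK1 : ∀ x, ∑ y, K x y = 1)
    {π : S → ℝ} {a c : ℝ} (hc : 0 < c) (hf : ∀ x, f x ∈ Set.Icc a (a + c)) {τ : ℕ}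
    (hmix : ∀ (h : S → ℝ) (u o : ℝ), (∀ x, h x ∈ Set.Icc u (u + o)) →
      ∀ x, |(K ^ τ).mulVec h x - ∑ y, π y * h y| ≤ o / 4)
    {r : ℕ} (hr : r < τ) (m : ℕ) :
    ∃ o u V : ℝ, 0 ≤ o ∧
      (∀ x, (additiveStep K f)^[r + m * τ] 0 x ∈ Set.Icc u (u + o)) ∧
      (∀ l s x, pathExpectation K f (fun s _ => Real.exp (l * s)) (r + m * τ) s x ≤
        Real.exp (l * (s + (additiveStep K f)^[r + m * τ] 0 x) + l ^ 2 * V / 8)) ∧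
      V ≤ 9 * (r + m * τ) * τ * c ^ 2 - (20 * τ * c * o + 4 * o ^ 2) / 3 := by
  -- With `T = τc` and `Q(o) = (20To + 4o²)/3`, one has `(T + o)² + Q(T + o/2) = 9T² + Q(o)`
  -- identically, so the bound on `V` propagates exactly under `o ↦ T + o/2`, `V ↦ V + (T + o)²`.
  induction m with
  | zero =>
    refine ⟨r * c, r * a, (r * c) ^ 2, by positivity, fun x => ?_, fun l s x => ?_, ?_⟩
    · have := additiveStep_iterate_zero_mem hK hK1 hf r x
      rw [zero_mul, add_zero]
      exact ⟨this.1, by linarith [this.2]⟩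
    · have := pathExpectation_exp_le hK hK1 hf (h := 0) (u := 0) (o := 0) (by simp) l r s x
      simpa using this
    · have h1 : (r : ℝ) ≤ τ := by exact_mod_cast hr.le
      have h2 : (0 : ℝ) ≤ r := by positivity
      have : (r : ℝ) * r * c ^ 2 ≤ r * τ * c ^ 2 := by gcongr
      push_cast
      nlinarith
  | succ m ih =>
    obtain ⟨o, u, V, ho, hosc, hmgf, hV⟩ := ih
    set N := r + m * τ with hN
    have hsucc : r + (m + 1) * τ = τ + N := by rw [hN]; ring
    rw [hsucc]
    set M := ∑ y, π y * (additiveStep K f)^[N] 0 y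
    refine ⟨τ * c + o / 2, τ * a + (M - o / 4), V + (τ * c + o) ^ 2, by positivity,
      fun x => ?_, fun l s x => ?_, ?_⟩
    · rw [Function.iterate_add_apply, additiveStep_iterate_eq]
      have h1 := additiveStep_iterate_zero_mem hK hK1 hf τ x
      have h2 := abs_le.1 (hmix _ u o hosc x)
      simp only [Pi.add_apply]
      constructor
      · linarith [h1.1, h2.1]
      · linarith [h1.2, h2.2]
    · rw [Function.iterate_add_apply]
      exact pathExpectation_exp_block hK hK1 hf hosc l τ N (hmgf l) s x
    · push_cast
      nlinarith

/-- The stationary mean of the expected sum is exactly `N` times that of `f`, so after mixing only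
`o/4` of the later bias survives. The combination `V + 4B²` is what the two-sided Chernoff bound
consumes. -/
theorem exists_mgf_bias_bound (hK : ∀ x y, 0 ≤ K x y) (hK1 : ∀ x, ∑ y, K x y = 1)
    {π : S → ℝ} (hπ : ∀ x, 0 ≤ π x) (hπ1 : ∑ x, π x = 1)
    (hst : ∀ y, ∑ x, π x * K x y = π y)
    {a c : ℝ} (hc : 0 < c) (hf : ∀ x, f x ∈ Set.Icc a (a + c)) {τ : ℕ} (hτ : 0 < τ)
    (hmix : ∀ (h : S → ℝ) (u o : ℝ), (∀ x, h x ∈ Set.Icc u (u + o)) →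
      ∀ x, |(K ^ τ).mulVec h x - ∑ y, π y * h y| ≤ o / 4)
    {N : ℕ} (hN : 1 ≤ N) :
    ∃ B V : ℝ,
      (∀ x, |(additiveStep K f)^[N] 0 x - N * ∑ y, π y * f y| ≤ B) ∧
      (∀ l x, pathExpectation K f (fun s _ => Real.exp (l * s)) N 0 x ≤
        Real.exp (l * (additiveStep K f)^[N] 0 x + l ^ 2 * V / 8)) ∧
      V + 4 * B ^ 2 < 9 * N * τ * c ^ 2 := by
  have hπf : ∑ y, π y * f y ∈ Set.Icc a (a + c) :=
    sum_stochastic_mem (K := fun _ y => π y) (fun _ y => hπ y) (fun _ => hπ1) hf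
      (Classical.choice (by
        by_contra hS
        rw [not_nonempty_iff] at hS
        simp at hπ1))
  have hbias : ∀ (L : ℕ) (x : S),
      |(additiveStep K f)^[L] 0 x - L * ∑ y, π y * f y| ≤ L * c := fun L x => by
    have h1 := additiveStep_iterate_zero_mem hK hK1 hf L x
    have h2 : (L : ℝ) * a ≤ L * ∑ y, π y * f y := by gcongr; exact hπf.1
    have h3 : L * ∑ y, π y * f y ≤ (L : ℝ) * (a + c) := by gcongr; exact hπf.2
    rw [abs_le]
    constructor
    · linarith [h1.1]
    · linarith [h1.2]
  have hτ0 : (0 : ℝ) < τ := by exact_mod_cast hτ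
  have hr := Nat.mod_lt N hτ
  have hdiv : N % τ + N / τ * τ = N := by rw [mul_comm]; exact Nat.mod_add_div N τ
  -- If `N < τ`, a single block gives `5N²c² < 9Nτc²`.
  rcases hm : N / τ with _ | m
  · rw [hm, zero_mul, add_zero] at hdiv
    refine ⟨N * c, (N * c) ^ 2, hbias N, fun l x => ?_, ?_⟩
    · have := pathExpectation_exp_le hK hK1 hf (h := 0) (u := 0) (o := 0) (by simp) l N 0 x
      simpa using this
    · have h1 : (N : ℝ) ≤ τ := by rw [← hdiv]; exact_mod_cast hr.le
      have h2 : (1 : ℝ) ≤ N := by exact_mod_cast hN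
      have h3 : (N : ℝ) * N * c ^ 2 ≤ N * τ * c ^ 2 := by gcongr
      have h4 : 0 < (N : ℝ) * N * c ^ 2 := by positivity
      nlinarith
  · rw [hm] at hdiv
    obtain ⟨o, u, V, ho, hosc, hmgf, hV⟩ := exists_mgf_bound hK hK1 hc hf hmix hr m
    have hcast : ((N % τ : ℕ) : ℝ) + m * τ = ((N % τ + m * τ : ℕ) : ℝ) := by push_cast; ring
    rw [hcast] at hV
    set L := N % τ + m * τ with hL
    have hsucc : N = τ + L := by rw [← hdiv, hL, ← hdiv]; simp; ring
    rw [hsucc]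
    -- With `T = τc`, the first block and the bias cost `(T + o)² + 4(T + o/4)² = 5T² + 4To +
    -- 5o²/4`; this is below `9T² + Q(o)`, where `Q(o) = (20To + 4o²)/3` is the reserve in `hV`.
    refine ⟨τ * c + o / 4, V + (τ * c + o) ^ 2, fun x => ?_, fun l x => ?_, ?_⟩
    · rw [Function.iterate_add_apply, additiveStep_iterate_eq]
      have h1 := hbias τ x
      have h2 := hmix _ u o hosc x
      rw [additiveStep_iterate_mean hst] at h2
      refine le_trans (le_of_eq ?_) ((abs_add_le _ _).trans (add_le_add h1 h2))
      simp only [Pi.add_apply]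
      congr 1; push_cast; ring
    · have := pathExpectation_exp_block hK hK1 hf hosc l τ L (hmgf l) 0 x
      rw [Function.iterate_add_apply]
      simpa using this
    · have h1 : 0 < (τ : ℝ) * c := by positivity
      push_cast
      nlinarith [mul_nonneg h1.le ho, sq_nonneg o, mul_pos h1 h1]

end PathExpectation
end PivotChain
namespace PivotChain

/-! ### From the process to the kernel, and Chernoff's bound -/

section MarkovChain

/-- Presents the sum as a function of the whole history, with weight `0` at time `0`. -/
theorem sum_Icc_one_eq_sum_fin (u : ℕ → ℝ) (M : ℕ) :
    ∑ t ∈ Finset.Icc 1 M, u t = ∑ i : Fin (M + 1), if i = 0 then 0 else u i := by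
  induction M with
  | zero => simp
  | succ M ih =>
    rw [Finset.sum_Icc_succ_top (Nat.le_add_left 1 M), Fin.sum_univ_castSucc, ih]
    simp [Fin.last_eq_zero_iff, Fin.castSucc_eq_zero_iff]

open MeasureTheory
variable {S Ω : Type*} [Fintype S] [MeasurableSpace S] [MeasurableSingletonClass S]
  [MeasurableSpace Ω] {μ : Measure Ω} [IsProbabilityMeasure μ]

omit [Fintype S] in
theorem integrable_comp_finite [Finite S] {Y : Ω → S} (hY : Measurable Y) (G : S → ℝ) :
    Integrable (fun ω => G (Y ω)) μ := by
  have : Integrable G (μ.map Y) :=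
    have := Measure.isProbabilityMeasure_map (μ := μ) hY.aemeasurable
    Integrable.of_finite
  exact this.comp_measurable hY

theorem integral_comp_fintype {Y : Ω → S} (hY : Measurable Y) (G : S → ℝ) :
    ∫ ω, G (Y ω) ∂μ = ∑ y, μ.real {ω | Y ω = y} * G y := by
  have := Measure.isProbabilityMeasure_map (μ := μ) hY.aemeasurable
  rw [← integral_map hY.aemeasurable (measurable_of_finite G).aestronglyMeasurable,
    integral_fintype Integrable.of_finite]
  refine Finset.sum_congr rfl fun y _ => ?_
  rw [smul_eq_mul, map_measureReal_apply hY (measurableSet_singleton y)]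
  rfl

/-- The state space is finite, so the cylinder probabilities determine the joint law of history and
next state. -/
theorem IsMarkovChain.integral_succ {K : S → S → ℝ} {X : ℕ → Ω → S}
    (hX : IsMarkovChain μ K X) (hXm : ∀ t, Measurable (X t)) (M : ℕ)
    (H : (Fin (M + 1) → S) → S → ℝ) :
    ∫ ω, H (fun i => X i ω) (X (M + 1) ω) ∂μ =
      ∫ ω, ∑ y, K (X M ω) y * H (fun i => X i ω) y ∂μ := by
  have hYm : Measurable fun ω (i : Fin (M + 1)) => X i ω := measurable_pi_lambda _ fun i => hXm i
  have e1 := integral_comp_fintype (μ := μ) (hYm.prodMk (hXm (M + 1))) fun q => H q.1 q.2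
  have e2 := integral_comp_fintype (μ := μ) hYm fun q => ∑ y, K (q (Fin.last M)) y * H q y
  simp only [Fin.val_last] at e2
  rw [e1, e2, Fintype.sum_prod_type]
  refine Finset.sum_congr rfl fun q _ => ?_
  rw [Finset.mul_sum]
  refine Finset.sum_congr rfl fun y _ => ?_
  rw [← mul_assoc]
  congr 1
  have h := hX M fun t => if h : t < M + 1 then q ⟨t, h⟩ else y
  simp only [Nat.lt_succ_self, lt_irrefl, dite_true, dite_false] at h
  have s1 : {ω | ((fun i : Fin (M + 1) => X i ω), X (M + 1) ω) = (q, y)} =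
      {ω | ∀ s ≤ M + 1, X s ω = if h : s < M + 1 then q ⟨s, h⟩ else y} := by
    ext ω
    simp only [Set.mem_ofPred_eq, Prod.mk.injEq, funext_iff]
    constructor
    · rintro ⟨h1, h2⟩ s hs
      split_ifs with h
      · exact h1 ⟨s, h⟩
      · rwa [show s = M + 1 by omega]
    · intro h
      refine ⟨fun i => ?_, ?_⟩
      · have := h i i.2.le
        rwa [dif_pos i.2] at this
      · simpa using h (M + 1) le_rfl
  have s2 : {ω | (fun i : Fin (M + 1) => X i ω) = q} =
      {ω | ∀ s ≤ M, X s ω = if h : s < M + 1 then q ⟨s, h⟩ else y} := by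
    ext ω
    simp only [Set.mem_ofPred_eq, funext_iff]
    constructor
    · intro h s hs
      rw [dif_pos (Nat.lt_succ_of_le hs)]
      exact h ⟨s, Nat.lt_succ_of_le hs⟩
    · intro h i
      have := h i (Nat.le_of_lt_succ i.2)
      rwa [dif_pos i.2] at this
  rw [s1, s2, h]
  rfl

theorem IsMarkovChain.integral_eq_pathExpectation {K : Matrix S S ℝ} {X : ℕ → Ω → S}
    (hX : IsMarkovChain μ K X) (hXm : ∀ t, Measurable (X t)) (f : S → ℝ) (φ : ℝ → S → ℝ)
    (N M : ℕ) :
    ∫ ω, φ (∑ t ∈ Finset.Icc 1 (M + N), f (X t ω)) (X (M + N) ω) ∂μ =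
      ∫ ω, pathExpectation K f φ N (∑ t ∈ Finset.Icc 1 M, f (X t ω)) (X M ω) ∂μ := by
  induction N generalizing M with
  | zero => rfl
  | succ N ih =>
    rw [show M + (N + 1) = M + 1 + N by ring, ih]
    have hsum : ∀ ω, ∑ t ∈ Finset.Icc 1 M, f (X t ω) =
        ∑ i : Fin (M + 1), if i = 0 then 0 else f (X i ω) := fun ω =>
      sum_Icc_one_eq_sum_fin (fun t => f (X t ω)) M
    have := hX.integral_succ hXm M fun q y => pathExpectation K f φ N
      ((∑ i : Fin (M + 1), if i = 0 then 0 else f (q i)) + f y) y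
    simp only [← hsum] at this
    simp only [pathExpectation, ← this]
    simp only [Finset.sum_Icc_succ_top (Nat.le_add_left 1 M)]

/-- A state to which no transition leads is almost surely never visited after time `0`. -/
theorem IsMarkovChain.ae_succ {K : S → S → ℝ} {X : ℕ → Ω → S}
    (hX : IsMarkovChain μ K X) (hXm : ∀ t, Measurable (X t)) {p : S → Prop}
    (hp : ∀ x y, ¬ p y → K x y = 0) (t : ℕ) : ∀ᵐ ω ∂μ, p (X (t + 1) ω) := by
  classical
  have := hX.integral_succ hXm t fun _ y => if p y then 0 else 1
  have h0 : ∀ x, ∑ y, K x y * (if p y then 0 else 1 : ℝ) = 0 := fun x =>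
    Finset.sum_eq_zero fun y _ => by
      split_ifs with h
      · simp
      · simp [hp x y h]
  simp only [h0, integral_zero] at this
  rw [integral_eq_zero_iff_of_nonneg (fun ω => by positivity)
    (integrable_comp_finite (hXm (t + 1)) fun y => if p y then (0 : ℝ) else 1)] at this
  filter_upwards [this] with ω hω
  by_contra h
  simp [h] at hω

variable [DecidableEq S]

/-- A Hoeffding-type bound for additive functionals of a Markov chain with an arbitrary initial
distribution, in terms of a time `τ` after which the oscillation of functions contracts. -/
theorem IsMarkovChain.measure_le_deviation_lt {K : Matrix S S ℝ} {X : ℕ → Ω → S}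
    (hX : IsMarkovChain μ K X) (hXm : ∀ t, Measurable (X t))
    (hK : ∀ x y, 0 ≤ K x y) (hK1 : ∀ x, ∑ y, K x y = 1)
    {π : S → ℝ} (hπ : ∀ x, 0 ≤ π x) (hπ1 : ∑ x, π x = 1)
    (hst : ∀ y, ∑ x, π x * K x y = π y) {f : S → ℝ}
    {a c : ℝ} (hc : 0 < c) (hf : ∀ x, f x ∈ Set.Icc a (a + c)) {τ : ℕ} (hτ : 0 < τ)
    (hmix : ∀ (h : S → ℝ) (u o : ℝ), (∀ x, h x ∈ Set.Icc u (u + o)) →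
      ∀ x, |(K ^ τ).mulVec h x - ∑ y, π y * h y| ≤ o / 4)
    {N : ℕ} (hN : 1 ≤ N) {d : ℝ} (hd : 0 < d) :
    μ.real {ω | d ≤ |∑ t ∈ Finset.Icc 1 N, f (X t ω) - N * ∑ x, π x * f x|} <
      2 * Real.exp (-(2 * d ^ 2) / (9 * N * τ * c ^ 2)) := by
  obtain ⟨B, V, hB, hmgf, hV⟩ := exists_mgf_bias_bound hK hK1 hπ hπ1 hst hc hf hτ hmix hN
  set W : ℝ := 9 * N * τ * c ^ 2 with hW
  have hW0 : 0 < W := by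
    have : (0 : ℝ) < N := by exact_mod_cast hN
    have : (0 : ℝ) < τ := by exact_mod_cast hτ
    positivity
  set m : ℝ := N * ∑ x, π x * f x with hm
  -- This minimizes `l² W / 8 - l d`, with value `-2d²/W`.
  set l : ℝ := 4 * d / W with hl
  have hl0 : 0 < l := by positivity
  set D : Ω → ℝ := fun ω => ∑ t ∈ Finset.Icc 1 N, f (X t ω) with hD
  have hmgf' : ∀ l' : ℝ, ∫ ω, Real.exp (l' * D ω) ∂μ =
      ∫ ω, pathExpectation K f (fun s _ => Real.exp (l' * s)) N 0 (X 0 ω) ∂μ := fun l' => by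
    have := hX.integral_eq_pathExpectation hXm f (fun s _ => Real.exp (l' * s)) N 0
    simpa using this
  set h := (additiveStep K f)^[N] 0 with hh
  have hYm : Measurable fun ω (i : Fin (N + 1)) => X i ω := measurable_pi_lambda _ fun i => hXm i
  have hDfin : ∀ ω, D ω = ∑ i : Fin (N + 1), if i = 0 then 0 else f (X i ω) := fun ω =>
    sum_Icc_one_eq_sum_fin (fun t => f (X t ω)) N
  have hDint : ∀ φ : ℝ → ℝ, Integrable (fun ω => φ (D ω)) μ := fun φ => by
    simp only [hDfin]
    exact integrable_comp_finite hYm fun q : Fin (N + 1) → S =>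
      φ (∑ i : Fin (N + 1), if i = 0 then 0 else f (q i))
  have hmarkov : Real.exp (l * d) * μ.real {ω | d ≤ |D ω - m|} ≤
      ∫ ω, (Real.exp (-(l * m)) * Real.exp (l * D ω) +
        Real.exp (l * m) * Real.exp (-l * D ω)) ∂μ := by
    refine le_trans ?_ (mul_meas_ge_le_integral_of_nonneg
      (Filter.Eventually.of_forall fun ω => by positivity)
      (hDint fun z => Real.exp (-(l * m)) * Real.exp (l * z) +
        Real.exp (l * m) * Real.exp (-l * z)) (Real.exp (l * d)))
    refine mul_le_mul_of_nonneg_left (measureReal_mono fun ω hω => ?_) (Real.exp_pos _).le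
    simp only [Set.mem_ofPred_eq, ← Real.exp_add] at hω ⊢
    rcases le_abs.1 hω with h1 | h1
    · refine le_add_of_le_of_nonneg (Real.exp_le_exp.2 ?_) (Real.exp_pos _).le
      nlinarith
    · refine le_add_of_nonneg_of_le (Real.exp_pos _).le (Real.exp_le_exp.2 ?_)
      nlinarith
  have hB' : 0 ≤ B := by
    have : Nonempty Ω := nonempty_of_isProbabilityMeasure μ
    exact (abs_nonneg _).trans (hB (X 0 (Classical.choice this)))
  have hint : ∫ ω, (Real.exp (-(l * m)) * Real.exp (l * D ω) +
        Real.exp (l * m) * Real.exp (-l * D ω)) ∂μ ≤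
      2 * Real.exp (l ^ 2 * (V + 4 * B ^ 2) / 8) := by
    rw [integral_add (hDint fun z => Real.exp (-(l * m)) * Real.exp (l * z))
      (hDint fun z => Real.exp (l * m) * Real.exp (-l * z)), integral_const_mul,
      integral_const_mul, hmgf', hmgf', ← integral_const_mul, ← integral_const_mul,
      ← integral_add (integrable_comp_finite (hXm 0) fun x => Real.exp (-(l * m)) *
        pathExpectation K f (fun s _ => Real.exp (l * s)) N 0 x)
        (integrable_comp_finite (hXm 0) fun x => Real.exp (l * m) *
        pathExpectation K f (fun s _ => Real.exp (-l * s)) N 0 x)]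
    -- Both tails are kept together: for a fixed start the bias `h x - m` enters through `cosh (l (h
    -- x - m)) ≤ exp (l² B² / 2)`. It thus only enlarges the variance term to `V + 4B²`, without
    -- reducing `d`.
    have hpt : ∀ x, Real.exp (-(l * m)) *
          pathExpectation K f (fun s _ => Real.exp (l * s)) N 0 x +
        Real.exp (l * m) * pathExpectation K f (fun s _ => Real.exp (-l * s)) N 0 x ≤
        2 * Real.exp (l ^ 2 * (V + 4 * B ^ 2) / 8) := fun x => by
      have hsq : (h x - m) ^ 2 ≤ B ^ 2 := sq_le_sq.2 (by rw [abs_of_nonneg hB']; exact hB x)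
      calc _ ≤ Real.exp (-(l * m)) * Real.exp (l * h x + l ^ 2 * V / 8) +
            Real.exp (l * m) * Real.exp (-l * h x + (-l) ^ 2 * V / 8) := by
            gcongr
            · exact hmgf l x
            · exact hmgf (-l) x
        _ = 2 * Real.exp (l ^ 2 * V / 8) * Real.cosh (l * (h x - m)) := by
            rw [Real.cosh_eq, ← Real.exp_add, ← Real.exp_add]
            rw [show 2 * Real.exp (l ^ 2 * V / 8) *
              ((Real.exp (l * (h x - m)) + Real.exp (-(l * (h x - m)))) / 2) =
              Real.exp (l ^ 2 * V / 8) * Real.exp (l * (h x - m)) +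
              Real.exp (l ^ 2 * V / 8) * Real.exp (-(l * (h x - m))) by ring,
              ← Real.exp_add, ← Real.exp_add]
            ring_nf
        _ ≤ 2 * Real.exp (l ^ 2 * V / 8) * Real.exp ((l * (h x - m)) ^ 2 / 2) := by
            gcongr
            exact Real.cosh_le_exp_half_sq _
        _ ≤ _ := by
            rw [mul_assoc, ← Real.exp_add]
            gcongr
            nlinarith [mul_le_mul_of_nonneg_left hsq (sq_nonneg l)]
    refine (integral_mono_of_nonneg ?_ (integrable_const _)
      (Filter.Eventually.of_forall fun ω => hpt (X 0 ω))).trans (by simp)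
    have hpos : ∀ l' x, 0 ≤ pathExpectation K f (fun s _ => Real.exp (l' * s)) N 0 x :=
      fun l' x => by
        have h0 := pathExpectation_mul_left (K := K) (f := f) 0
          (fun s _ => Real.exp (l' * s)) N 0 x
        rw [zero_mul] at h0
        refine h0.ge.trans (pathExpectation_mono hK hf N 0 x fun s _ _ => ?_)
        rw [zero_mul]; exact (Real.exp_pos _).le
    exact Filter.Eventually.of_forall fun ω => add_nonneg
      (mul_nonneg (Real.exp_pos _).le (hpos _ _)) (mul_nonneg (Real.exp_pos _).le (hpos _ _))
  have hlt : 2 * Real.exp (l ^ 2 * (V + 4 * B ^ 2) / 8) < 2 * Real.exp (l ^ 2 * W / 8) := by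
    gcongr
  have hfin := lt_of_le_of_lt (hmarkov.trans hint) hlt
  have hexp : 2 * Real.exp (l ^ 2 * W / 8) =
      Real.exp (l * d) * (2 * Real.exp (-(2 * d ^ 2) / W)) := by
    rw [mul_left_comm (Real.exp (l * d)), ← Real.exp_add]
    congr 2
    rw [hl]; field_simp; ring
  rw [hexp] at hfin
  exact lt_of_mul_lt_mul_left hfin (Real.exp_pos _).le

end MarkovChain
end PivotChain
-- Total variation and mixing time
namespace PivotChain

theorem abs_sum_sub_sum_le {S : Type*} [Fintype S] {p q : S → ℝ} (hp : ∑ x, p x = 1)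
    (hq : ∑ x, q x = 1) {h : S → ℝ} {u o : ℝ} (hh : ∀ x, h x ∈ Set.Icc u (u + o)) :
    |∑ x, p x * h x - ∑ x, q x * h x| ≤ tvDist p q * o := by
  -- Equal masses allow centring `h` at the midpoint of its range, which saves the factor `2`
  -- absorbed by `tvDist`.
  have e : ∑ x, p x * h x - ∑ x, q x * h x = ∑ x, (p x - q x) * (h x - (u + o / 2)) := by
    simp only [sub_mul, mul_sub, Finset.sum_sub_distrib, ← Finset.sum_mul, hp, hq]
    ring
  rw [e, tvDist, Finset.mul_sum, Finset.sum_mul]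
  refine (Finset.abs_sum_le_sum_abs _ _).trans (Finset.sum_le_sum fun x _ => ?_)
  rw [abs_mul]
  have : |h x - (u + o / 2)| ≤ o / 2 := by
    rw [abs_le]; constructor <;> linarith [(hh x).1, (hh x).2]
  calc _ ≤ |p x - q x| * (o / 2) := by gcongr
    _ = _ := by ring

theorem pow_row_sum {S : Type*} [Fintype S] [DecidableEq S] {K : Matrix S S ℝ}
    (hK1 : ∀ x, ∑ y, K x y = 1) (t : ℕ) (x : S) : ∑ y, (K ^ t) x y = 1 := by
  have h : (K ^ t).mulVec 1 = 1 := by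
    induction t with
    | zero => simp
    | succ t ih =>
      rw [pow_succ, ← Matrix.mulVec_mulVec]
      rwa [show K.mulVec 1 = 1 by ext x; simpa [Matrix.mulVec, dotProduct] using hK1 x]
  simpa [Matrix.mulVec, dotProduct] using congrFun h x

/-- A nonempty set in the well-ordered `ℕ∞` attains its infimum. -/
theorem exists_mixingTime_eq {S : Type*} [Fintype S] [DecidableEq S] {P : Matrix S S ℝ}
    {π : S → ℝ} {ε : ℝ} (h : mixingTime P π ε ≠ ⊤) :
    ∃ t : ℕ, mixingTime P π ε = t ∧ ∀ x, tvDist ((P ^ t) x) π ≤ ε := by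
  unfold mixingTime at h ⊢
  rw [← sInf_image] at h ⊢
  have hne : ((fun t : ℕ => (t : ℕ∞)) '' {t | ∀ x, tvDist ((P ^ t) x) π ≤ ε}).Nonempty := by
    rw [Set.nonempty_iff_ne_empty]
    intro h0
    exact h (by rw [h0, sInf_empty])
  obtain ⟨t, ht, hte⟩ := csInf_mem hne
  exact ⟨t, hte.symm, ht⟩

/-! ### The pivot chain: positivity, reversibility, reduction to the root -/

section Pivot
variable {k n : ℕ} [NeZero k] {F : Motif k} {G : Network n}

omit [NeZero k] in
theorem homWeight_nonneg (x : Fin k → Fin n) : 0 ≤ homWeight F G x :=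
  mul_nonneg (Finset.prod_nonneg fun _ _ => Finset.prod_nonneg fun _ _ =>
    Real.rpow_nonneg (G.A_nonneg _ _) _) (Finset.prod_nonneg fun i _ => (G.α_pos (x i)).le)

/-- A rooted tree can be mapped into the network with an arbitrary location of the root. -/
theorem exists_homWeight_pos (hF : F.IsRootedTree) (hout : ∀ a, ∃ b, 0 < G.A a b) (a : Fin n) :
    ∃ x : Fin k → Fin n, x 0 = a ∧ 0 < homWeight F G x := by
  obtain ⟨h01, hroot, hpar⟩ := hF
  choose next hnext using hout
  choose p hp hpe using hpar
  -- Recursion from parent to child: each node goes to a chosen out-neighbour of its parent's image.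
  let x : Fin k → Fin n := wellFounded_lt.fix fun i rec =>
    if h : i = 0 then a else next (rec (p i h) (hp i h))
  have hx : ∀ i, x i = if h : i = 0 then a else next (x (p i h)) := fun i =>
    wellFounded_lt.fix_eq _ i
  refine ⟨x, by rw [hx]; simp, mul_pos (Finset.prod_pos fun i _ => Finset.prod_pos fun j _ => ?_)
    (Finset.prod_pos fun i _ => G.α_pos _)⟩
  rcases h01 i j with h | h
  · simp [h]
  · have hj : j ≠ 0 := by
      rintro rfl
      rw [hroot] at h
      exact zero_ne_one h
    have hi : i = p j hj := (hpe j hj i).1 (by rw [h]; exact one_pos)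
    rw [h, Real.rpow_one, hx j, dif_neg hj, ← hi]
    exact hnext _

theorem homDensity_pos (hF : F.IsRootedTree) (hout : ∀ a, ∃ b, 0 < G.A a b) (a : Fin n) :
    0 < homDensity F G := by
  obtain ⟨x, -, hx⟩ := exists_homWeight_pos hF hout a
  exact Finset.sum_pos' (fun y _ => homWeight_nonneg y) ⟨x, Finset.mem_univ x, hx⟩

omit [NeZero k] in
theorem homDist_nonneg (x : Fin k → Fin n) : 0 ≤ homDist F G x :=
  div_nonneg (homWeight_nonneg x) (Finset.sum_nonneg fun y _ => homWeight_nonneg y)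

theorem homDist_sum (hF : F.IsRootedTree) (hout : ∀ a, ∃ b, 0 < G.A a b) (a : Fin n) :
    ∑ x, homDist F G x = 1 := by
  simp only [homDist, ← Finset.sum_div]
  exact div_self (homDensity_pos hF hout a).ne'

theorem rootMarginal_pos (hF : F.IsRootedTree) (hout : ∀ a, ∃ b, 0 < G.A a b) (a : Fin n) :
    0 < rootMarginal F G a := by
  obtain ⟨x, hx0, hx⟩ := exists_homWeight_pos hF hout a
  exact Finset.sum_pos' (fun y _ => homDist_nonneg y)
    ⟨x, by simp [hx0], div_pos hx (homDensity_pos hF hout a)⟩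

theorem sum_root_fiber (φ : (Fin k → Fin n) → ℝ) :
    ∑ x, φ x = ∑ a, ∑ x with x 0 = a, φ x :=
  (Finset.sum_fiberwise Finset.univ (fun x : Fin k → Fin n => x 0) φ).symm

theorem rootMarginal_sum (hF : F.IsRootedTree) (hout : ∀ a, ∃ b, 0 < G.A a b) (a : Fin n) :
    ∑ b, rootMarginal F G b = 1 := by
  rw [← homDist_sum hF hout a, sum_root_fiber]
  rfl

theorem walk_weight_nonneg (G : Network n) (a b : Fin n) :
    0 ≤ G.α a * max (G.A a b) (G.A b a) * G.α b :=
  mul_nonneg (mul_nonneg (G.α_pos a).le (le_max_of_le_left (G.A_nonneg a b))) (G.α_pos b).le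

theorem walk_degree_pos (hout : ∀ a, ∃ b, 0 < G.A a b) (a : Fin n) :
    0 < ∑ c, G.α a * max (G.A a c) (G.A c a) * G.α c := by
  obtain ⟨b, hb⟩ := hout a
  exact Finset.sum_pos' (fun c _ => walk_weight_nonneg G a c) ⟨b, Finset.mem_univ b,
    mul_pos (mul_pos (G.α_pos a) (lt_max_of_lt_left hb)) (G.α_pos b)⟩

theorem walkKernel_nonneg (a b : Fin n) : 0 ≤ walkKernel G a b :=
  div_nonneg (walk_weight_nonneg G a b) (Finset.sum_nonneg fun c _ => walk_weight_nonneg G a c)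

theorem walkKernel_sum (hout : ∀ a, ∃ b, 0 < G.A a b) (a : Fin n) :
    ∑ b, walkKernel G a b = 1 := by
  simp only [walkKernel, ← Finset.sum_div]
  exact div_self (walk_degree_pos hout a).ne'

theorem walkKernel_eq_zero_symm (hout : ∀ a, ∃ b, 0 < G.A a b) {a b : Fin n}
    (h : walkKernel G a b = 0) : walkKernel G b a = 0 := by
  rw [walkKernel, div_eq_zero_iff, or_iff_left (walk_degree_pos hout a).ne'] at h
  rw [walkKernel, div_eq_zero_iff]
  left
  rw [max_comm, mul_right_comm, mul_comm (G.α b), mul_right_comm]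
  exact h

theorem acceptProb_nonneg (hF : F.IsRootedTree) (hout : ∀ a, ∃ b, 0 < G.A a b) (a b : Fin n) :
    0 ≤ acceptProb F G a b :=
  le_min (div_nonneg (mul_nonneg (rootMarginal_pos hF hout b).le (walkKernel_nonneg _ _))
    (mul_nonneg (rootMarginal_pos hF hout a).le (walkKernel_nonneg _ _))) zero_le_one

theorem rootKernel_nonneg (hF : F.IsRootedTree) (hout : ∀ a, ∃ b, 0 < G.A a b) (a b : Fin n) :
    0 ≤ rootKernel F G a b := by
  unfold rootKernel
  split_ifs
  · rw [sub_nonneg, ← walkKernel_sum hout a]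
    refine (Finset.sum_le_sum fun c _ => mul_le_of_le_one_right (walkKernel_nonneg a c)
      (min_le_right _ _)).trans (Finset.sum_le_sum_of_subset_of_nonneg (Finset.filter_subset _ _)
      fun c _ _ => walkKernel_nonneg a c)
  · exact mul_nonneg (walkKernel_nonneg a b) (acceptProb_nonneg hF hout a b)

theorem rootKernel_sum (a : Fin n) : ∑ b, rootKernel F G a b = 1 := by
  rw [← Finset.sum_filter_add_sum_filter_not Finset.univ (fun b => b = a)]
  have h1 : ∑ b with b = a, rootKernel F G a b = rootKernel F G a a := by
    rw [Finset.filter_eq' Finset.univ a, if_pos (Finset.mem_univ a), Finset.sum_singleton]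
  have h2 : ∑ b with ¬ b = a, rootKernel F G a b =
      ∑ b with b ≠ a, walkKernel G a b * acceptProb F G a b :=
    Finset.sum_congr rfl fun b hb => by rw [rootKernel, if_neg (Finset.mem_filter.1 hb).2]
  rw [h1, h2, rootKernel, if_pos rfl, sub_add_cancel]

theorem rootKernel_detailed_balance (hF : F.IsRootedTree) (hout : ∀ a, ∃ b, 0 < G.A a b)
    (a b : Fin n) :
    rootMarginal F G a * rootKernel F G a b = rootMarginal F G b * rootKernel F G b a := by
  by_cases hab : b = a
  · rw [hab]
  -- The accepted flow is the minimum of the two proposed flows, hence symmetric. If `Ψ(c,d) = 0`,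
  -- then `Ψ(d,c) = 0` as well and both sides vanish.
  have key : ∀ c d : Fin n, rootMarginal F G c * (walkKernel G c d * acceptProb F G c d) =
      min (rootMarginal F G d * walkKernel G d c) (rootMarginal F G c * walkKernel G c d) := by
    intro c d
    have hc := rootMarginal_pos hF hout c
    rcases (walkKernel_nonneg (G := G) c d).eq_or_lt with h | h
    · rw [← h, walkKernel_eq_zero_symm hout h.symm]; simp
    · have hpos := mul_pos hc h
      rw [← mul_assoc, acceptProb, mul_min_of_nonneg _ _ hpos.le, mul_div_cancel₀ _ hpos.ne',
        mul_one]
  rw [rootKernel, rootKernel, if_neg hab, if_neg (Ne.symm hab), key, key, min_comm]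

/-- The conditional expectation of `h` under `π_{F → G}` given the location of the root. -/
noncomputable def rootCondExp (F : Motif k) (G : Network n) (h : (Fin k → Fin n) → ℝ)
    (b : Fin n) : ℝ :=
  ∑ y with y 0 = b, homDist F G y / rootMarginal F G b * h y

theorem rootCondExp_comp_root (hF : F.IsRootedTree) (hout : ∀ a, ∃ b, 0 < G.A a b)
    (v : Fin n → ℝ) : rootCondExp F G (fun x => v (x 0)) = v := by
  ext b
  have : ∀ y ∈ Finset.univ.filter (fun y : Fin k → Fin n => y 0 = b),
      homDist F G y / rootMarginal F G b * v (y 0) =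
        homDist F G y * (v b / rootMarginal F G b) := fun y hy => by
    rw [(Finset.mem_filter.1 hy).2]; ring
  rw [rootCondExp, Finset.sum_congr rfl this, ← Finset.sum_mul]
  exact mul_div_cancel₀ _ (rootMarginal_pos hF hout b).ne'

theorem chainKernel_mulVec (h : (Fin k → Fin n) → ℝ) (x : Fin k → Fin n) :
    ∑ y, chainKernel F G x y * h y = (rootKernel F G).mulVec (rootCondExp F G h) (x 0) := by
  rw [sum_root_fiber, Matrix.mulVec, dotProduct]
  refine Finset.sum_congr rfl fun b _ => ?_
  rw [rootCondExp, Finset.mul_sum]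
  refine Finset.sum_congr rfl fun y hy => ?_
  rw [chainKernel, (Finset.mem_filter.1 hy).2, mul_assoc]

theorem chainKernel_nonneg (hF : F.IsRootedTree) (hout : ∀ a, ∃ b, 0 < G.A a b)
    (x y : Fin k → Fin n) : 0 ≤ chainKernel F G x y :=
  mul_nonneg (rootKernel_nonneg hF hout _ _)
    (div_nonneg (homDist_nonneg y) (rootMarginal_pos hF hout _).le)

theorem chainKernel_sum (hF : F.IsRootedTree) (hout : ∀ a, ∃ b, 0 < G.A a b)
    (x : Fin k → Fin n) : ∑ y, chainKernel F G x y = 1 := by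
  have h := chainKernel_mulVec (F := F) (G := G) (fun _ => 1) x
  rw [rootCondExp_comp_root hF hout fun _ => 1] at h
  simpa [Matrix.mulVec, dotProduct, rootKernel_sum] using h

/-- Detailed balance lifts from the root, since the new non-root nodes are drawn from the
conditional law. -/
theorem chainKernel_stationary (hF : F.IsRootedTree) (hout : ∀ a, ∃ b, 0 < G.A a b)
    (y : Fin k → Fin n) : ∑ x, homDist F G x * chainKernel F G x y = homDist F G y := by
  have h : ∀ x, homDist F G x * chainKernel F G x y =
      homDist F G y * chainKernel F G y x := fun x => by
    have hx := (rootMarginal_pos hF hout (x 0)).ne'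
    have hy := (rootMarginal_pos hF hout (y 0)).ne'
    have := rootKernel_detailed_balance hF hout (x 0) (y 0)
    unfold chainKernel
    field_simp
    linear_combination homDist F G x * homDist F G y * this
  rw [Finset.sum_congr rfl fun x _ => h x, ← Finset.mul_sum, chainKernel_sum hF hout, mul_one]

/-- Each step resamples all nodes given the root, so the past matters only through the pivot. At
exponent `0` nothing has been resampled and this fails, hence `t + 1`. -/
theorem chainKernel_pow_mulVec (hF : F.IsRootedTree) (hout : ∀ a, ∃ b, 0 < G.A a b)
    (h : (Fin k → Fin n) → ℝ) (t : ℕ) (x : Fin k → Fin n) :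
    (Matrix.of (chainKernel F G) ^ (t + 1)).mulVec h x =
      (rootKernel F G ^ (t + 1)).mulVec (rootCondExp F G h) (x 0) := by
  induction t generalizing x with
  | zero => simpa [Matrix.mulVec, dotProduct] using chainKernel_mulVec h x
  | succ t ih =>
    rw [pow_succ' (Matrix.of _), pow_succ' (rootKernel F G), ← Matrix.mulVec_mulVec,
      ← Matrix.mulVec_mulVec]
    have e := chainKernel_mulVec (F := F) (G := G) (fun y =>
      (rootKernel F G ^ (t + 1)).mulVec (rootCondExp F G h) (y 0)) x
    rw [rootCondExp_comp_root hF hout] at e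
    rw [← e, funext ih]
    rfl

theorem sum_rootMarginal_mul_rootCondExp (hF : F.IsRootedTree)
    (hout : ∀ a, ∃ b, 0 < G.A a b) (h : (Fin k → Fin n) → ℝ) :
    ∑ b, rootMarginal F G b * rootCondExp F G h b = ∑ y, homDist F G y * h y := by
  rw [sum_root_fiber (fun y => homDist F G y * h y)]
  refine Finset.sum_congr rfl fun b _ => ?_
  rw [rootCondExp, Finset.mul_sum]
  refine Finset.sum_congr rfl fun y _ => ?_
  have := (rootMarginal_pos hF hout b).ne'
  field_simp

theorem rootCondExp_mem (hF : F.IsRootedTree) (hout : ∀ a, ∃ b, 0 < G.A a b)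
    {h : (Fin k → Fin n) → ℝ} {u v : ℝ} (hh : ∀ x, h x ∈ Set.Icc u v) (b : Fin n) :
    rootCondExp F G h b ∈ Set.Icc u v := by
  have hw : ∀ y : Fin k → Fin n, 0 ≤ homDist F G y / rootMarginal F G b := fun y =>
    div_nonneg (homDist_nonneg y) (rootMarginal_pos hF hout b).le
  constructor
  · rw [← congrFun (rootCondExp_comp_root hF hout fun _ => u) b]
    exact Finset.sum_le_sum fun y _ => mul_le_mul_of_nonneg_left (hh y).1 (hw y)
  · rw [← congrFun (rootCondExp_comp_root hF hout fun _ => v) b]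
    exact Finset.sum_le_sum fun y _ => mul_le_mul_of_nonneg_left (hh y).2 (hw y)

theorem chainKernel_pow_contraction (hF : F.IsRootedTree) (hout : ∀ a, ∃ b, 0 < G.A a b)
    {τ : ℕ} (hτ : 0 < τ) (hmix : ∀ a, tvDist ((rootKernel F G ^ τ) a) (rootMarginal F G) ≤ 1 / 4)
    {h : (Fin k → Fin n) → ℝ} {u o : ℝ} (hh : ∀ x, h x ∈ Set.Icc u (u + o))
    (x : Fin k → Fin n) :
    |(Matrix.of (chainKernel F G) ^ τ).mulVec h x - ∑ y, homDist F G y * h y| ≤ o / 4 := by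
  obtain ⟨t, rfl⟩ := Nat.exists_eq_succ_of_ne_zero hτ.ne'
  have ho : 0 ≤ o := by linarith [(hh x).1, (hh x).2]
  rw [Nat.succ_eq_add_one, chainKernel_pow_mulVec hF hout,
    ← sum_rootMarginal_mul_rootCondExp hF hout]
  refine (abs_sum_sub_sum_le (pow_row_sum rootKernel_sum _ _)
    (rootMarginal_sum hF hout (x 0)) (rootCondExp_mem hF hout hh)).trans ?_
  have := mul_le_mul_of_nonneg_right (hmix (x 0)) ho
  linarith

end Pivot
end PivotChain

/-! ### The concentration inequality -/

open PivotChain in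

theorem mainTheorem10 {k n : ℕ} [NeZero k] (hn : 2 ≤ n)
    (F : PivotChain.Motif k) (hF : F.IsRootedTree)
    (G : PivotChain.Network n) (hG : G.IsIrreducible)
    (hout : ∀ a, ∃ b, 0 < G.A a b)
    {Ω : Type*} [MeasurableSpace Ω] (μ : MeasureTheory.Measure Ω)
    [MeasureTheory.IsProbabilityMeasure μ]
    (X : ℕ → Ω → (Fin k → Fin n)) (hXm : ∀ t, Measurable (X t))
    (hX0 : ∀ᵐ ω ∂μ, PivotChain.IsHom F G (X 0 ω))
    (hX : PivotChain.IsMarkovChain μ (PivotChain.chainKernel F G) X)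
    (g : (Fin k → Fin n) → ℝ) (c : ℝ) (hc : 0 < c)
    (hg : ∀ x y, PivotChain.IsHom F G x → PivotChain.IsHom F G y → |g x - g y| ≤ c)
    (δ : ℝ) (hδ : 0 < δ) (N : ℕ) (hN : 1 ≤ N) :
    μ.real {ω | δ ≤ |PivotChain.homMean F G g
        - (1 / (N : ℝ)) * ∑ t ∈ Finset.Icc 1 N, g (X t ω)|} <
      2 * Real.exp (-(2 * δ ^ 2 * N) / (9 * c ^ 2) *
        ((PivotChain.mixingTime (PivotChain.rootKernel F G)
          (PivotChain.rootMarginal F G) (1 / 4) : ENNReal)⁻¹).toReal) := by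
  classical

  have htriv : ∀ s : Set Ω, μ.real s < 2 * Real.exp 0 := fun s => by
    have := MeasureTheory.measureReal_le_one (μ := μ) (s := s)
    rw [Real.exp_zero]; linarith
  by_cases htop : mixingTime (rootKernel F G) (rootMarginal F G) (1 / 4) = ⊤
  · rw [htop]; simpa using htriv _
  obtain ⟨τ, hτe, hmix⟩ := exists_mixingTime_eq htop
  rw [hτe]
  -- For `τ = 0` the inverse is `⊤` in `ENNReal`, whose `toReal` is `0`; as for `τ = ⊤`, the right
  -- side is `2`.
  rcases Nat.eq_zero_or_pos τ with rfl | hτ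
  · simpa using htriv _
  let a₀ : Fin n := ⟨0, by omega⟩
  obtain ⟨x₀, -, hx₀⟩ := exists_homWeight_pos hF hout a₀
  have hx₀ : IsHom F G x₀ := div_pos hx₀ (homDensity_pos hF hout a₀)
  -- Off the homomorphisms `g` is uncontrolled; overwriting it there by `g x₀` makes the oscillation
  -- at most `c` everywhere. Neither the mean nor, almost surely, the states at times `t ≥ 1` see
  -- the change.
  let f : (Fin k → Fin n) → ℝ := fun x => if IsHom F G x then g x else g x₀
  have hfosc : ∀ x y, f x - f y ≤ c := fun x y => by
    simp only [f]
    split_ifs with h1 h2 h2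
    · exact (abs_le.1 (hg _ _ h1 h2)).2
    · exact (abs_le.1 (hg _ _ h1 hx₀)).2
    · exact (abs_le.1 (hg _ _ hx₀ h2)).2
    · simpa using hc.le
  obtain ⟨xm, hxm⟩ := @Finite.exists_min _ _ _ ⟨x₀⟩ _ f
  have hmean : homMean F G g = ∑ x, homDist F G x * f x :=
    Finset.sum_congr rfl fun x _ => by
      simp only [f]
      split_ifs with h
      · rfl
      · rw [le_antisymm (not_lt.1 h) (homDist_nonneg x)]; simp
  have hae : ∀ᵐ ω ∂μ, ∀ t, IsHom F G (X (t + 1) ω) :=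
    MeasureTheory.ae_all_iff.2 fun t => hX.ae_succ hXm (fun x y h => by
      rw [chainKernel, le_antisymm (not_lt.1 h) (homDist_nonneg y)]; simp) t
  have hN0 : (0 : ℝ) < N := by exact_mod_cast hN
  have hmain := IsMarkovChain.measure_le_deviation_lt (K := Matrix.of (chainKernel F G)) hX hXm
    (chainKernel_nonneg hF hout) (chainKernel_sum hF hout) homDist_nonneg
    (homDist_sum hF hout a₀) (chainKernel_stationary hF hout) hc
    (f := f) (a := f xm) (fun x => ⟨hxm x, by linarith [hfosc x xm]⟩) hτ
    (fun h u o hh x => chainKernel_pow_contraction hF hout hτ hmix hh x) hN (mul_pos hδ hN0)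
  have hset : μ.real {ω | δ ≤ |homMean F G g - (1 / (N : ℝ)) * ∑ t ∈ Finset.Icc 1 N, g (X t ω)|} =
      μ.real {ω | δ * N ≤
        |∑ t ∈ Finset.Icc 1 N, f (X t ω) - N * ∑ x, homDist F G x * f x|} := by
    refine MeasureTheory.measureReal_congr ?_
    filter_upwards [hae] with ω hω
    have hsum : ∑ t ∈ Finset.Icc 1 N, g (X t ω) = ∑ t ∈ Finset.Icc 1 N, f (X t ω) :=
      Finset.sum_congr rfl fun t ht => by
        obtain ⟨s, rfl⟩ := Nat.exists_eq_add_of_le' (Finset.mem_Icc.1 ht).1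
        simp only [f, if_pos (hω s)]
    have habs : |∑ t ∈ Finset.Icc 1 N, f (X t ω) - N * ∑ x, homDist F G x * f x| =
        |homMean F G g - (1 / (N : ℝ)) * ∑ t ∈ Finset.Icc 1 N, g (X t ω)| * N := by
      rw [← abs_of_pos hN0, ← abs_mul, abs_of_pos hN0, abs_sub_comm, hsum, hmean]
      congr 1
      field_simp
    apply propext
    change δ ≤ _ ↔ δ * N ≤ _
    rw [habs]
    exact (mul_le_mul_iff_left₀ hN0).symm
  rw [hset]
  refine hmain.trans_eq ?_
  have hτ0 : (0 : ℝ) < τ := by exact_mod_cast hτ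
  congr 2
  rw [ENat.toENNReal_coe, ENNReal.toReal_inv, ENNReal.toReal_natCast]
  field_simp
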